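/- Let $R$ be a commutative Noetherian ring with $1\neq 0$. Write $V^{*}=\mathrm{Hom}_R(V,R)$ and $\otimes=\otimes_R$. For a (unital, associative) $R$-algebra $A$ let $$A^{\circ}=\{f\in A^{*} : f(I)=0 \text{ for some two-sided ideal } I\subseteq A \text{ with } A/I \text{ finitely generated over } R\},$$ an $R$-submodule of $A^{*}$. A bilinear pairing $\langle -,-\rangle : V\times W\to R$ of $R$-modules is an *$\alpha$-pairing* if for every $R$-module $M$ the map $M\otimes W\to \mathrm{Hom}_R(V,M)$, $\sum m_i\otimes w_i\mapsto [v\mapsto \sum \langle v,w_i\rangle m_i]$, is injective. An $R$-bialgebra (Hopf $R$-algebra) $H$ is an *$\alpha$-bialgebra* (*Hopf $\alpha$-algebra*) if the evaluation pairing $(H,H^{\circ})$ is an $\alpha$-pairing. A pairing $(H,K)$ of $R$-bialgebras is a *bialgebra pairing* if the induced maps $H\to K^{*}$ and $K\to H^{*}$ are $R$-algebra morphisms, $K^{*}$ and $H^{*}$ being algebras under convolution; it is a *Hopf pairing* if moreover $H$ and $K$ are Hopf algebras. 1. If $H$ is an $\alpha$-bialgebra (respectively a Hopf $\alpha$-algebra),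 then the $R$-module $H^{\circ}$ carries an $R$-bialgebra (respectively Hopf $R$-algebra) structure for which the evaluation pairing $(H,H^{\circ})$ is a bialgebra $\alpha$-pairing (respectively a Hopf $\alpha$-pairing). If moreover $H$ is commutative, then $H^{\circ}$ is cocommutative; if $H$ is cocommutative, then $H^{\circ}$ is commutative. 2. Suppose that $R$ is also hereditary, that is, every ideal of $R$ is a projective $R$-module. Then $H\mapsto H^{\circ}$ (with a bialgebra structure for which the evaluation pairing $(H,H^\circ)$ is a bialgebra $\alpha$-pairing), $f\mapsto [\varphi\mapsto \varphi\circ f]$, defines contravariant functors $$\mathbf{Big}_R\to\mathbf{Big}_R,\quad \mathbf{CBig}_R\to\mathbf{CCBig}_R,\quad \mathbf{CCBig}_R\to\mathbf{CBig}_R,$$ $$\mathbf{Hopf}_R\to\mathbf{Hopf}_R,\quad \mathbf{CHopf}_R\to\mathbf{CCHopf}_R,\quad \mathbf{CCHopf}_R\to\mathbf{CHopf}_R,$$ where $\mathbf{Big}_R$ and $\mathbf{Hopf}_R$ are the categories of $R$-bialgebras and of Hopf $R$-algebras, and the prefixes $\mathbf{C}$ and $\mathbf{CC}$ denote the full subcategories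 of commutative and of cocommutative objects. These functors are self-adjoint (on the right): there are bijections $$\mathrm{Hom}(H,K^{\circ})\;\cong\;\mathrm{Hom}(K,H^{\circ}),\qquad f\mapsto [\,k\mapsto (h\mapsto f(h)(k))\,],$$ natural in $H$ and $K$, for $H,K$ in $\mathbf{Big}_R$, and likewise for $H,K$ in $\mathbf{Hopf}_R$; restricted to the full subcategories, they make $\mathbf{CBig}_R\to\mathbf{CCBig}_R$ and $\mathbf{CCBig}_R\to\mathbf{CBig}_R$ adjoint to each other on the right, and likewise $\mathbf{CHopf}_R\to\mathbf{CCHopf}_R$ and $\mathbf{CCHopf}_R\to\mathbf{CHopf}_R$. -/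

import Mathlib

open CategoryTheory Opposite TensorProduct

universe u v w

/-- The continuous (finite) dual `A° ⊆ A* = Hom(A, R)` of an algebra `A` over a Noetherian ring
`R`: the linear forms vanishing on some two-sided ideal `I` with `A ⧸ I` finitely generated
over `R`. -/
def finiteDual (R : Type u) [CommRing R] [IsNoetherianRing R]
    (A : Type v) [Ring A] [Algebra R A] : Submodule R (Module.Dual R A) where
  carrier := {f | ∃ I : Ideal A, I.IsTwoSided ∧ Module.Finite R (A ⧸ I) ∧ ∀ x ∈ I, f x = 0}
  zero_mem' := by
    refine ⟨⊤, inferInstance, ?_, fun x _ => rfl⟩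
    have : Subsingleton (A ⧸ (⊤ : Ideal A)) := Submodule.Quotient.subsingleton_iff.2 rfl
    infer_instance
  add_mem' := by
    rintro f g ⟨I, hI, hIf, hfI⟩ ⟨J, hJ, hJf, hgJ⟩
    refine ⟨I ⊓ J, ⟨fun b h => ⟨hI.mul_mem_of_left b h.1, hJ.mul_mem_of_left b h.2⟩⟩, ?_, ?_⟩
    · let φ : A →ₗ[R] (A ⧸ I) × (A ⧸ J) :=
        (I.mkQ.restrictScalars R).prod (J.mkQ.restrictScalars R)
      have hφ : LinearMap.ker φ = (I ⊓ J).restrictScalars R := by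
        ext x
        simp [φ]
      have e : (A ⧸ (I ⊓ J).restrictScalars R) ≃ₗ[R] LinearMap.range φ :=
        (Submodule.quotEquivOfEq _ _ hφ.symm).trans φ.quotKerEquivRange
      have h1 : Module.Finite R (LinearMap.range φ) := inferInstance
      have h2 : Module.Finite R (A ⧸ (I ⊓ J).restrictScalars R) := Module.Finite.equiv e.symm
      exact Module.Finite.equiv (Submodule.Quotient.restrictScalarsEquiv R (I ⊓ J))
    · intro x hx
      simp [hfI x hx.1, hgJ x hx.2]
  smul_mem' := by
    rintro r f ⟨I, hI, hIf, hfI⟩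
    exact ⟨I, hI, hIf, fun x hx => by simp [hfI x hx]⟩

section Pairings

variable {R : Type u} [CommRing R]

/-- For a pairing `⟨-,-⟩ : V × W → R` and a module `M`, the canonical map
`M ⊗ W → Hom(V, M)`, `m ⊗ w ↦ [x ↦ ⟨x, w⟩ m]`. -/
noncomputable def alphaMap {V : Type v} {W : Type w} [AddCommGroup V] [Module R V]
    [AddCommGroup W] [Module R W] (P : V →ₗ[R] W →ₗ[R] R)
    (M : Type*) [AddCommGroup M] [Module R M] : M ⊗[R] W →ₗ[R] (V →ₗ[R] M) :=
  TensorProduct.lift ((LinearMap.smulRightₗ ∘ₗ P.flip).flip)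

/-- The `α`-condition for a pairing: all the maps `M ⊗ W → Hom(V, M)` are injective.
(Every element of `M ⊗ W` comes from a finitely generated submodule of `M`, so the universe in
which `M` ranges is immaterial as soon as it contains that of `R`.) -/
def IsAlphaPairing {V : Type v} {W : Type w} [AddCommGroup V] [Module R V]
    [AddCommGroup W] [Module R W] (P : V →ₗ[R] W →ₗ[R] R) : Prop :=
  ∀ (M : Type (max u v w)) [AddCommGroup M] [Module R M], Function.Injective (alphaMap P M)

/-- A pairing `P = (H, K)` of bialgebras is a bialgebra pairing if both induced maps
`H → K*` and `K → H*` are algebra morphisms, the duals being convolution algebras.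
A Hopf pairing is a bialgebra pairing between Hopf algebras. -/
structure IsBialgebraPairing {H : Type v} {K : Type w} [Ring H] [Bialgebra R H]
    [Ring K] [Bialgebra R K] (P : H →ₗ[R] K →ₗ[R] R) : Prop where
  left_one : WithConv.toConv (P 1) = 1
  left_mul : ∀ a b : H,
    WithConv.toConv (P (a * b)) = WithConv.toConv (P a) * WithConv.toConv (P b)
  right_one : WithConv.toConv (P.flip 1) = 1
  right_mul : ∀ c d : K,
    WithConv.toConv (P.flip (c * d)) = WithConv.toConv (P.flip c) * WithConv.toConv (P.flip d)

variable [IsNoetherianRing R]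

/-- `A` is an `α`-algebra if the evaluation pairing `(A, A°)` satisfies the `α`-condition. An
`α`-bialgebra (a Hopf `α`-algebra) is a bialgebra (a Hopf algebra) that is an `α`-algebra. -/
def IsAlphaAlgebra (R : Type u) [CommRing R] [IsNoetherianRing R]
    (A : Type v) [Ring A] [Algebra R A] : Prop :=
  IsAlphaPairing (R := R) (V := A) (W := finiteDual R A) (finiteDual R A).subtype.flip

/-- The evaluation pairing `(h, f) ↦ f h` between `H` and a copy `K` of the module `H°`. -/
noncomputable def evalPairing {H : Type v} {K : Type w} [Ring H] [Algebra R H]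
    [AddCommGroup K] [Module R K] (e : K ≃ₗ[R] finiteDual R H) : H →ₗ[R] K →ₗ[R] R :=
  ((finiteDual R H).subtype ∘ₗ e.toLinearMap).flip

end Pairings

section Functors

/-- Commutative bialgebras. -/
def BialgCat.comm (R : Type u) [CommRing R] : ObjectProperty (BialgCat.{v} R) :=
  fun H => ∀ a b : H, a * b = b * a

/-- Cocommutative bialgebras. -/
def BialgCat.cocomm (R : Type u) [CommRing R] : ObjectProperty (BialgCat.{v} R) :=
  fun H => Coalgebra.IsCocomm R H

/-- Commutative Hopf algebras. -/
def HopfAlgCat.comm (R : Type u) [CommRing R] : ObjectProperty (HopfAlgCat.{v} R) :=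
  fun H => ∀ a b : H, a * b = b * a

/-- Cocommutative Hopf algebras. -/
def HopfAlgCat.cocomm (R : Type u) [CommRing R] : ObjectProperty (HopfAlgCat.{v} R) :=
  fun H => Coalgebra.IsCocomm R H

variable {R : Type u} [CommRing R] [IsNoetherianRing R]

/-- The statement that `(-)°` is a contravariant functor `C → D`, where `C` and `D` are categories
of bialgebras with additional properties or structure (`U` and `V` forget these): a functor
`Cᵒᵖ ⥤ D` whose value at `H` is the module `H°` with a bialgebra structure making the evaluation
pairing `(H, H°)` a bialgebra `α`-pairing (which determines that structure), and whose
value at `f : H ⟶ K` is `K° → H°`, `φ ↦ φ ∘ f`. -/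
structure FiniteDualFunctor {C : Type*} [Category C] {D : Type*} [Category D]
    (U : C ⥤ BialgCat.{v} R) (V : D ⥤ BialgCat.{v} R) where
  /-- the functor -/
  functor : Cᵒᵖ ⥤ D
  /-- the identification of the module underlying its value at `H` with `H°` -/
  equiv : ∀ H : C, V.obj (functor.obj (op H)) ≃ₗ[R] finiteDual R (U.obj H)
  isBialgebraPairing : ∀ H : C, IsBialgebraPairing (evalPairing (equiv H))
  isAlphaPairing : ∀ H : C, IsAlphaPairing (evalPairing (equiv H))
  map_apply : ∀ {H K : C} (f : H ⟶ K) (φ : V.obj (functor.obj (op K))) (h : U.obj H),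
    evalPairing (equiv H) h ((V.map (functor.map f.op)).toBialgHom φ) =
      evalPairing (equiv K) ((U.map f).toBialgHom h) φ

/-- `(-)° : C → D` and `(-)° : D → C` are adjoint on the right, through the bijections
`Hom(H, K°) ≃ Hom(K, H°)`, `f ↦ [k ↦ f(-)(k)]`, natural in `H ∈ C` and `K ∈ D`. -/
def FiniteDualFunctor.IsAdjointTo {C : Type*} [Category C] {D : Type*} [Category D]
    {U : C ⥤ BialgCat.{v} R} {V : D ⥤ BialgCat.{v} R}
    (F : FiniteDualFunctor U V) (G : FiniteDualFunctor V U) : Prop :=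
  ∃ adj : F.functor.rightOp ⊣ G.functor,
    ∀ (H : C) (K : D) (f : H ⟶ G.functor.obj (op K)) (h : U.obj H) (k : V.obj K),
      evalPairing (F.equiv H) h
          ((V.map ((adj.homEquiv H (op K)).symm f).unop).toBialgHom k) =
        evalPairing (G.equiv K) k ((U.map f).toBialgHom h)

end Functors

/-! A linear form on `A` lies in `A°` exactly when its translates span a finitely generated module.
This criterion, with Sweedler sums, shows that `H°` is closed under convolution and under the
transpose of the antipode.

The `α`-condition does two things. With `M = W` and `M = W ⊗ W` it embeds tensor powers of `H°` into
multilinear forms on `H`, so each identity in `H°` can be tested on elements of `H`, where it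
becomes a transposed identity of `H`. Applied to a quotient of `R^H`, it shows that `(a, b) ↦ f (a *
b)` comes from `H° ⊗ H°` (`hasComul_evalPairing`), so the comultiplication exists.

Over a hereditary ring, finitely many elements of `A°` map `A` onto a submodule of some `R^n`, which
is finitely generated projective; a dual basis of it gives the `α`-condition for every algebra
(`isAlphaPairing_evalPairing_of_hereditary`).

A morphism `L → H°` is the same thing as a bialgebra pairing of `H` with `L`
(`IsBialgebraPairing.lift`). Bialgebra pairings are symmetric under exchanging the two variables,
whence the self-adjunction. -/

section FiniteDual

/-! ### Translates of linear forms and membership in `A°` -/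

variable {R : Type u} [CommRing R] {A : Type v} [Ring A] [Algebra R A]

/-- The dual of an algebra as a bimodule: `bitranslate a b f = [x ↦ f (a * x * b)]`. -/
def bitranslate (a b : A) : Module.Dual R A →ₗ[R] Module.Dual R A :=
  LinearMap.lcomp R R (LinearMap.mulRight R b ∘ₗ LinearMap.mulLeft R a)

@[simp]
lemma bitranslate_apply (a b : A) (f : Module.Dual R A) (x : A) :
    bitranslate a b f x = f (a * x * b) := rfl

lemma finite_quotient_of_ker_eq {M : Type*} [AddCommMonoid M] [Module R M] [IsNoetherian R M]
    (S : A →ₗ[R] M) {I : Ideal A} (h : LinearMap.ker S = I.restrictScalars R) :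
    Module.Finite R (A ⧸ I) := by
  let _ : AddCommGroup M := Module.addCommMonoidToAddCommGroup R
  have e : (A ⧸ I.restrictScalars R) ≃ₗ[R] LinearMap.range S :=
    (Submodule.quotEquivOfEq _ _ h.symm).trans S.quotKerEquivRange
  have : Module.Finite R (A ⧸ I.restrictScalars R) := Module.Finite.equiv e.symm
  exact Module.Finite.equiv (Submodule.Quotient.restrictScalarsEquiv R I)

lemma isNoetherian_end_of_finite (R : Type*) [CommRing R] [IsNoetherianRing R] (M : Type*)
    [AddCommMonoid M] [Module R M] [Module.Finite R M] : IsNoetherian R (M →ₗ[R] M) := by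
  let _ : AddCommGroup M := Module.addCommMonoidToAddCommGroup R
  have : IsNoetherian R M := isNoetherian_of_isNoetherianRing_of_finite R M
  exact isNoetherian_linearMap R M M

variable [IsNoetherianRing R]

/-- Every `f ∈ A°` lies in a finitely generated sub-bimodule of `A*` contained in `A°`. -/
lemma exists_fg_of_mem_finiteDual {f : Module.Dual R A} (hf : f ∈ finiteDual R A) :
    ∃ N : Submodule R (Module.Dual R A), N.FG ∧ N ≤ finiteDual R A ∧
      ∀ a b, bitranslate a b f ∈ N := by
  obtain ⟨I, hI, hfin, hfI⟩ := hf
  let π : A →ₗ[R] A ⧸ I := I.mkQ.restrictScalars R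
  have key : ∀ g : Module.Dual R A, (∀ x ∈ I, g x = 0) → g ∈ LinearMap.range π.dualMap := by
    intro g hg
    have hker : LinearMap.ker π ≤ LinearMap.ker g := by
      intro x hx
      exact hg x ((Submodule.Quotient.mk_eq_zero I).1 hx)
    have hsurj : LinearMap.range π = ⊤ := LinearMap.range_eq_top.2 I.mkQ_surjective
    rw [LinearMap.range_dualMap_eq_dualAnnihilator_ker_of_surjective _ I.mkQ_surjective]
    rw [Submodule.mem_dualAnnihilator]
    exact hker
  have : Module.Finite R (Module.Dual R (A ⧸ I)) := by
    have : IsNoetherian R (Module.Dual R (A ⧸ I)) := isNoetherian_linearMap _ _ _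
    infer_instance
  -- The forms vanishing on `I` are the image of `Hom(A/I, R)`, which is finitely generated since
  -- `A/I` is finite and `R` Noetherian.
  refine ⟨LinearMap.range π.dualMap, ?_, ?_, fun a b => key _ fun x hx => ?_⟩
  · rw [LinearMap.range_eq_map]
    exact this.fg_top.map _
  · rintro _ ⟨g, rfl⟩
    refine ⟨I, hI, hfin, fun x hx => ?_⟩
    have : π x = 0 := (Submodule.Quotient.mk_eq_zero I).2 hx
    simp [this]
  · exact hfI _ (I.mul_mem_right _ (I.mul_mem_left _ hx))

/-- The annihilator of a module of linear forms stable under translation is cofinite. -/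
lemma mem_finiteDual_of_stable {N : Submodule R (Module.Dual R A)} (hN : N.FG)
    (hs : ∀ g ∈ N, ∀ a, bitranslate 1 a g ∈ N) {f : Module.Dual R A} (hf : f ∈ N) :
    f ∈ finiteDual R A := by
  have hfin : Module.Finite R N := Module.Finite.iff_fg.2 hN
  have hEnd : IsNoetherian R (N →ₗ[R] N) := isNoetherian_end_of_finite R N
  -- `A` acts on `N` by translation; the kernel of this action is the required ideal, and `A ⧸ I`
  -- embeds in the Noetherian module `End N`.
  let S : A →ₗ[R] (N →ₗ[R] N) :=
    LinearMap.mk₂ R (fun x g => ⟨bitranslate 1 x g.1, hs g.1 g.2 x⟩)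
      (fun x y g => by ext; simp [mul_add]) (fun r x g => by ext; simp)
      (fun x g h => by ext; simp) (fun r x g => by ext; simp)
  let I : Ideal A :=
    { carrier := {x | ∀ g ∈ N, ∀ a, g (a * x) = 0}
      zero_mem' := by simp
      add_mem' := fun hx hy g hg a => by simp [mul_add, hx g hg a, hy g hg a]
      smul_mem' := fun c x hx g hg a => by simpa [mul_assoc] using hx g hg (a * c) }
  have hI : I.IsTwoSided := ⟨fun {x} c hx g hg a => by
    simpa [mul_assoc] using hx _ (hs g hg c) a⟩
  have hker : LinearMap.ker S = I.restrictScalars R := by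
    ext x
    constructor
    · intro hx g hg a
      have h : S x ⟨g, hg⟩ = 0 := by rw [LinearMap.mem_ker.1 hx]; rfl
      simpa [S] using congr((($h : N) : Module.Dual R A) a)
    · intro hx
      refine LinearMap.mem_ker.2 (LinearMap.ext fun g => Subtype.ext (LinearMap.ext fun a => ?_))
      simpa [S] using hx g.1 g.2 a
  exact ⟨I, hI, finite_quotient_of_ker_eq S hker, fun x hx => by simpa using hx f hf 1⟩

/-- A linear form whose translates `[x ↦ f (x * a)]` lie in a finitely generated module
belongs to `A°`. -/
lemma mem_finiteDual_of_fg {f : Module.Dual R A} {N : Submodule R (Module.Dual R A)} (hN : N.FG)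
    (hf : ∀ a, bitranslate 1 a f ∈ N) : f ∈ finiteDual R A := by
  have hNoeth : IsNoetherian R N := isNoetherian_of_fg_of_noetherian N hN
  -- `N` itself need not be stable, but the span of the translates is, and it is finitely generated
  -- because `N` is Noetherian.
  have hle : Submodule.span R (Set.range fun a => bitranslate 1 a f) ≤ N :=
    Submodule.span_le.2 (Set.range_subset_iff.2 hf)
  refine mem_finiteDual_of_stable (Submodule.FG.of_le_of_isNoetherian hle) (fun g hg a => ?_)
    (Submodule.subset_span ⟨1, by ext; simp⟩)
  refine Submodule.span_induction ?_ (by simp) (fun x y _ _ hx hy => ?_)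
    (fun r x _ hx => ?_) hg
  · rintro _ ⟨b, rfl⟩
    exact Submodule.subset_span ⟨a * b, by ext; simp [mul_assoc]⟩
  · simpa using add_mem hx hy
  · simpa using Submodule.smul_mem _ r hx

/-- Finitely many elements of `A°` vanish on a common cofinite two-sided ideal. -/
lemma exists_ideal_of_finite {ι : Type*} [Finite ι] (f : ι → finiteDual R A) :
    ∃ I : Ideal A, I.IsTwoSided ∧ Module.Finite R (A ⧸ I) ∧
      ∀ i, ∀ x ∈ I, (f i : Module.Dual R A) x = 0 := by
  choose I hI hfin hfI using fun i => (f i).2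
  let φ : A →ₗ[R] ∀ i, A ⧸ I i := LinearMap.pi fun i => (I i).mkQ.restrictScalars R
  have hφ : LinearMap.ker φ = (⨅ i, I i).restrictScalars R := by
    ext x
    simp only [φ, LinearMap.mem_ker, funext_iff, LinearMap.pi_apply, Pi.zero_apply,
      Submodule.restrictScalars_mem, Submodule.mem_iInf]
    exact forall_congr' fun i => Submodule.Quotient.mk_eq_zero (I i)
  have hN : IsNoetherian R (∀ i, A ⧸ I i) := inferInstance
  refine ⟨⨅ i, I i, ⟨fun b h => ?_⟩,
    finite_quotient_of_ker_eq φ hφ, fun i x hx => ?_⟩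
  · simp only [Submodule.mem_iInf] at h ⊢
    exact fun i => (hI i).mul_mem_of_left b (h i)
  · exact hfI i x ((Submodule.mem_iInf _).1 hx i)

end FiniteDual

/-! ### Consequences of the `α`-condition -/

section AlphaPairing

variable {R : Type u} [CommRing R] {V : Type v} {W : Type w} [AddCommGroup V] [Module R V]
  [AddCommGroup W] [Module R W] {P : V →ₗ[R] W →ₗ[R] R}

@[simp]
lemma alphaMap_tmul {M : Type*} [AddCommGroup M] [Module R M] (m : M) (w : W) (x : V) :
    alphaMap P M (m ⊗ₜ w) x = P x w • m := rfl

lemma alphaMap_comp_rTensor {M N : Type*} [AddCommGroup M] [Module R M] [AddCommGroup N]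
    [Module R N] (g : M →ₗ[R] N) (t : M ⊗[R] W) (x : V) :
    alphaMap P N (g.rTensor W t) x = g (alphaMap P M t x) := by
  induction t with
  | zero => simp
  | tmul m w => simp
  | add s t hs ht => simp [hs, ht]

/-- The `α`-condition speaks of one universe; this gives access to modules with a copy there, such
as `R` and `W` through `ULift`. -/
lemma IsAlphaPairing.injective_of_equiv (hP : IsAlphaPairing P) {M : Type*} [AddCommGroup M]
    [Module R M] {N : Type (max u v w)} [AddCommGroup N] [Module R N] (e : M ≃ₗ[R] N) :
    Function.Injective (alphaMap P M) := by
  refine (injective_iff_map_eq_zero _).2 fun t ht => ?_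
  have h : e.toLinearMap.rTensor W t = 0 := hP N <| by
    ext x
    simp [alphaMap_comp_rTensor, ht]
  exact (LinearEquiv.rTensor W e).injective (h.trans (map_zero _).symm)

lemma IsAlphaPairing.of_equiv (hP : IsAlphaPairing P) {K : Type w} [AddCommGroup K] [Module R K]
    {Q : V →ₗ[R] K →ₗ[R] R} (e : K ≃ₗ[R] W) (h : ∀ x k, Q x k = P x (e k)) :
    IsAlphaPairing Q := by
  intro M _ _ s t hst
  have key : ∀ t : M ⊗[R] K, alphaMap P M (e.lTensor M t) = alphaMap Q M t := by
    intro t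
    induction t with
    | zero => simp
    | tmul m w => ext x; simp [h]
    | add s t hs ht => simp only [map_add, hs, ht]
  exact (LinearEquiv.lTensor M e).injective (hP M (by rw [key, key, hst]))

/-- The second variable of an `α`-pairing is nondegenerate. -/
lemma IsAlphaPairing.ext (hP : IsAlphaPairing P) {w w' : W} (h : ∀ x, P x w = P x w') :
    w = w' := by
  have := hP.injective_of_equiv (N := ULift.{max u v w} R) ULift.moduleEquiv.symm
    (a₁ := (1 : R) ⊗ₜ w) (a₂ := 1 ⊗ₜ w') (by ext x; simp [h])
  simpa using congr(TensorProduct.lid R W $this)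

lemma IsAlphaPairing.ext_alphaMap (hP : IsAlphaPairing P) {M : Type w} [AddCommGroup M]
    [Module R M] {s t : M ⊗[R] W} (h : ∀ x, alphaMap P M s x = alphaMap P M t x) : s = t :=
  hP.injective_of_equiv (N := ULift.{max u v w} M) ULift.moduleEquiv.symm (LinearMap.ext h)

/-- The pairing of a tensor in `W ⊗ W` with `x ⊗ y`. -/
noncomputable def pair₂ (P : V →ₗ[R] W →ₗ[R] R) (x y : V) : W ⊗[R] W →ₗ[R] R :=
  LinearMap.mul' R R ∘ₗ TensorProduct.map (P x) (P y)

@[simp]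
lemma pair₂_tmul (x y : V) (w w' : W) : pair₂ P x y (w ⊗ₜ w') = P x w * P y w' := rfl

lemma pair₂_eq_alphaMap (x y : V) (t : W ⊗[R] W) : pair₂ P x y t = P x (alphaMap P W t y) := by
  induction t with
  | zero => simp
  | tmul m w => simp [mul_comm]
  | add s t hs ht => simp only [map_add, hs, ht, LinearMap.add_apply]

/-- The `α`-condition with `M = W` removes the second tensor factor, and nondegeneracy removes the
first. -/
lemma IsAlphaPairing.ext₂ (hP : IsAlphaPairing P) {s t : W ⊗[R] W}
    (h : ∀ x y, pair₂ P x y s = pair₂ P x y t) : s = t :=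
  hP.ext_alphaMap fun y => hP.ext fun x => by
    rw [← pair₂_eq_alphaMap, ← pair₂_eq_alphaMap, h]

/-- If all the values of the map given by `t ∈ M ⊗ W` lie in a submodule of `M`, then `t` comes
from that submodule. -/
lemma IsAlphaPairing.exists_rTensor_eq (hP : IsAlphaPairing P) {M N : Type (max u v w)}
    [AddCommGroup M] [Module R M] [AddCommGroup N] [Module R N] (g : N →ₗ[R] M) (t : M ⊗[R] W)
    (h : ∀ x, alphaMap P M t x ∈ LinearMap.range g) : ∃ s, g.rTensor W s = t := by
  -- By right exactness it suffices that `t` dies in `(M ⧸ range g) ⊗ W`, and the `α`-condition for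
  -- this quotient detects that.
  have hex := rTensor_exact W (LinearMap.exact_map_mkQ_range g)
    (Submodule.mkQ_surjective (LinearMap.range g))
  refine (hex t).1 (hP _ ?_)
  ext x
  simp only [alphaMap_comp_rTensor, map_zero, LinearMap.zero_apply, Submodule.mkQ_apply,
    Submodule.Quotient.mk_eq_zero]
  exact h x

end AlphaPairing
-- The coalgebra dual to an algebra
section DualCoalgebra

open Coalgebra

variable {R : Type u} [CommRing R] {H : Type v} {W : Type w} [Ring H] [Algebra R H]
  [AddCommGroup W] [Module R W] {P : H →ₗ[R] W →ₗ[R] R}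

/-- A pairing of an algebra `H` with a module `W` such that the multiplication of `H` is dual to
some map `W → W ⊗ W`. -/
def HasComul (P : H →ₗ[R] W →ₗ[R] R) : Prop :=
  ∀ w, ∃ t : W ⊗[R] W, ∀ a b, pair₂ P a b t = P (a * b) w

variable (hP : IsAlphaPairing P) (hc : HasComul P)

/-- The comultiplication of `W` dual to the multiplication of `H`. -/
noncomputable def dualComul : W →ₗ[R] W ⊗[R] W where
  toFun w := (hc w).choose
  -- By `ext₂` the chosen tensor is the only possible one, so the choice is automatically linear.
  map_add' w w' := hP.ext₂ fun a b => by
    rw [(hc _).choose_spec, map_add, map_add, (hc _).choose_spec, (hc _).choose_spec]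
  map_smul' r w := hP.ext₂ fun a b => by
    rw [(hc _).choose_spec, map_smul, map_smul, (hc _).choose_spec, RingHom.id_apply]

lemma pair₂_dualComul (a b : H) (w : W) : pair₂ P a b (dualComul hP hc w) = P (a * b) w :=
  (hc w).choose_spec a b

lemma alphaMap_dualComul_apply (a b : H) (w : W) :
    P a (alphaMap P W (dualComul hP hc w) b) = P (a * b) w := by
  rw [← pair₂_eq_alphaMap, pair₂_dualComul]

/-- Both sides evaluate `(id ⊗ g) t` at `a ⊗ b ⊗ c`. Reassociating puts `W ⊗ W` in the place of the
coefficient module `M`, as needed to test coassociativity. -/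
lemma alphaMap_assoc_symm_lTensor (g : W →ₗ[R] W ⊗[R] W) (t : W ⊗[R] W) (a b c : H) :
    pair₂ P a b (alphaMap P (W ⊗[R] W)
      ((TensorProduct.assoc R W W W).symm (g.lTensor W t)) c) =
      LinearMap.mul' R R (TensorProduct.map (P a) (pair₂ P b c ∘ₗ g) t) := by
  induction t with
  | zero => simp
  | add s t hs ht => simp only [map_add, LinearMap.add_apply, hs, ht]
  | tmul x y =>
    simp only [LinearMap.lTensor_tmul, TensorProduct.map_tmul, LinearMap.comp_apply]
    induction g y with
    | zero => simp
    | add s t hs ht => simp only [TensorProduct.tmul_add, map_add, LinearMap.add_apply, hs, ht]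
    | tmul y z => simp; ring

/-- The coalgebra structure dual to an algebra, along an `α`-pairing. -/
@[reducible]
noncomputable def dualCoalgebra : Coalgebra R W where
  comul := dualComul hP hc
  counit := P 1
  coassoc := by
    ext w
    refine (TensorProduct.assoc R W W W).symm.injective (hP.ext_alphaMap fun c => hP.ext₂ ?_)
    intro a b
    simp only [LinearMap.comp_apply, LinearEquiv.coe_coe, LinearEquiv.symm_apply_apply]
    rw [alphaMap_assoc_symm_lTensor, alphaMap_comp_rTensor, pair₂_dualComul,
      alphaMap_dualComul_apply]
    have h : pair₂ P b c ∘ₗ dualComul hP hc = P (b * c) := by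
      ext w
      exact pair₂_dualComul hP hc b c w
    rw [h, mul_assoc]
    exact (pair₂_dualComul hP hc a (b * c) w).symm
  rTensor_counit_comp_comul := by
    ext w
    refine (TensorProduct.lid R W).injective (hP.ext fun a => ?_)
    have h : ∀ t : W ⊗[R] W, P a (TensorProduct.lid R W ((P 1).rTensor W t)) = pair₂ P 1 a t := by
      intro t
      induction t with
      | zero => simp
      | add s t hs ht => simp only [map_add, hs, ht]
      | tmul x y => simp
    simp [h, pair₂_dualComul]
  lTensor_counit_comp_comul := by
    ext w
    refine (TensorProduct.rid R W).injective (hP.ext fun a => ?_)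
    have h : ∀ t : W ⊗[R] W, P a (TensorProduct.rid R W ((P 1).lTensor W t)) = pair₂ P a 1 t := by
      intro t
      induction t with
      | zero => simp
      | add s t hs ht => simp only [map_add, hs, ht]
      | tmul x y => simp [mul_comm]
    simp [h, pair₂_dualComul]

end DualCoalgebra

/-! ### The bialgebra dual to a bialgebra -/

section DualBialgebra

open Coalgebra WithConv

variable {R : Type u} [CommRing R] {H : Type v} {W : Type w} [Ring H] [Ring W]

section Bialgebra

variable [Bialgebra R H] [Algebra R W] {P : H →ₗ[R] W →ₗ[R] R}

/-- The map `W → H*` induced by a pairing is an algebra morphism. -/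
structure IsConvPairing (P : H →ₗ[R] W →ₗ[R] R) : Prop where
  one : toConv (P.flip 1) = 1
  mul : ∀ c d : W, toConv (P.flip (c * d)) = toConv (P.flip c) * toConv (P.flip d)

lemma IsConvPairing.apply_one (h : IsConvPairing P) (a : H) : P a 1 = counit (R := R) a :=
  congr(($h.one) a)

lemma IsConvPairing.apply_mul (h : IsConvPairing P) {ι : Type*} {a : H} (r : Repr R a ι)
    (c d : W) : P a (c * d) = ∑ i ∈ r.index, P (r.left i) c * P (r.right i) d :=
  congr($(h.mul c d) a).trans (r.convMul_apply _ _)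

lemma IsConvPairing.pair₂_one (h : IsConvPairing P) (a b : H) :
    pair₂ P a b 1 = counit (R := R) a * counit (R := R) b := by
  rw [Algebra.TensorProduct.one_def, pair₂_tmul, h.apply_one, h.apply_one]

/-- The product of `W ⊗ W` is the convolution product with respect to the coalgebra `H ⊗ H`. -/
lemma IsConvPairing.pair₂_mul (h : IsConvPairing P) {ι κ : Type*} {a b : H} (ra : Repr R a ι)
    (rb : Repr R b κ) (s t : W ⊗[R] W) :
    pair₂ P a b (s * t) = ∑ i ∈ ra.index, ∑ j ∈ rb.index,
      pair₂ P (ra.left i) (rb.left j) s * pair₂ P (ra.right i) (rb.right j) t := by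
  induction s with
  | zero => simp
  | add s s' hs hs' => simp only [add_mul, map_add, hs, hs', Finset.sum_add_distrib]
  | tmul x x' =>
    induction t with
    | zero => simp
    | add s s' hs hs' => simp only [mul_add, map_add, hs, hs', Finset.sum_add_distrib]
    | tmul y y' =>
      simp only [Algebra.TensorProduct.tmul_mul_tmul, pair₂_tmul, h.apply_mul ra, h.apply_mul rb,
        Finset.sum_mul_sum]
      exact Finset.sum_congr rfl fun i _ => Finset.sum_congr rfl fun j _ => by ring

/-- The bialgebra structure dual to a bialgebra, along an `α`-pairing. -/
@[reducible]
noncomputable def dualBialgebra (hP : IsAlphaPairing P) (hc : HasComul P)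
    (h : IsConvPairing P) : Bialgebra R W :=
  let _ : Coalgebra R W := dualCoalgebra hP hc
  Bialgebra.mk' R W
    -- Each compatibility for `W` is the transpose of one for `H`. For instance, multiplicativity of
    -- the counit of `W` comes from `Δ 1 = 1 ⊗ 1` in `H`, and `Δ 1 = 1 ⊗ 1` in `W` from
    -- multiplicativity of the counit of `H`.
    (by change P 1 1 = 1; simp [h.apply_one])
    (by
      intro c d
      change P 1 (c * d) = P 1 c * P 1 d
      have h1 : comul (R := R) (1 : H) = 1 := Bialgebra.comul_one
      let r : Repr R (1 : H) Unit := ⟨{()}, fun _ => 1, fun _ => 1, by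
        simp [Algebra.TensorProduct.one_def]⟩
      simp [h.apply_mul r, r])
    (hP.ext₂ fun a b => by
      change pair₂ P a b (dualComul hP hc 1) = _
      rw [pair₂_dualComul, h.pair₂_one, h.apply_one, Bialgebra.counit_mul])
    (by
      intro c d
      refine hP.ext₂ fun a b => ?_
      change pair₂ P a b (dualComul hP hc (c * d)) =
        pair₂ P a b (dualComul hP hc c * dualComul hP hc d)
      rw [pair₂_dualComul, h.pair₂_mul (ℛ R a) (ℛ R b), h.apply_mul ((ℛ R a).mul (ℛ R b))]
      simp [pair₂_dualComul, Finset.sum_product])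

lemma isBialgebraPairing_dualBialgebra (hP : IsAlphaPairing P) (hc : HasComul P)
    (h : IsConvPairing P) :
    @IsBialgebraPairing R _ H W _ _ _ (dualBialgebra hP hc h) P :=
  let _ : Bialgebra R W := dualBialgebra hP hc h
  { left_one := rfl
    left_mul := fun a b => WithConv.ext <| LinearMap.ext fun w =>
      (pair₂_dualComul hP hc a b w).symm
    right_one := h.one
    right_mul := h.mul }

end Bialgebra

end DualBialgebra

/-! ### Commutativity and cocommutativity across a pairing -/

section BialgebraPairing

open Coalgebra WithConv

variable {R : Type u} [CommRing R] {H : Type v} {W : Type w} [Ring H] [Ring W]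
  [Bialgebra R H] [Bialgebra R W] {P : H →ₗ[R] W →ₗ[R] R}

lemma IsBialgebraPairing.flip (h : IsBialgebraPairing P) : IsBialgebraPairing P.flip where
  left_one := h.right_one
  left_mul := h.right_mul
  right_one := h.left_one
  right_mul := h.left_mul

lemma IsBialgebraPairing.isConvPairing (h : IsBialgebraPairing P) : IsConvPairing P where
  one := h.right_one
  mul := h.right_mul

lemma IsBialgebraPairing.one_apply (h : IsBialgebraPairing P) (c : W) :
    P 1 c = counit (R := R) c := congr(($h.left_one) c)

lemma IsBialgebraPairing.pair₂_comul (h : IsBialgebraPairing P) (a b : H) (c : W) :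
    pair₂ P a b (comul c) = P (a * b) c := congr($(h.left_mul a b) c).symm

lemma IsBialgebraPairing.isCocomm (h : IsBialgebraPairing P) (hP : IsAlphaPairing P)
    (hH : ∀ a b : H, a * b = b * a) : IsCocomm R W where
  comm_comp_comul := by
    ext c
    refine hP.ext₂ fun a b => ?_
    have hs : ∀ t : W ⊗[R] W, pair₂ P a b (TensorProduct.comm R W W t) = pair₂ P b a t := by
      intro t
      induction t with
      | zero => simp
      | add s t hs ht => simp only [map_add, hs, ht]
      | tmul x y => simp [mul_comm]
    change pair₂ P a b (TensorProduct.comm R W W (comul c)) = _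
    rw [hs, h.pair₂_comul, h.pair₂_comul, hH]

/-- The convolution algebra `H*` of a cocommutative `H` is commutative, and `W` embeds in it by
nondegeneracy. -/
lemma IsBialgebraPairing.mul_comm (h : IsBialgebraPairing P) (hP : IsAlphaPairing P)
    (hH : IsCocomm R H) (c d : W) : c * d = d * c := by
  refine hP.ext fun a => ?_
  have := (h.right_mul c d).trans ((_root_.mul_comm _ _).trans (h.right_mul d c).symm)
  exact congr($this a)

end BialgebraPairing

/-! ### The antipode of the dual -/

section DualHopf

open Coalgebra WithConv

variable {R : Type u} [CommRing R] {H : Type v} {W : Type w} [Ring H] [Ring W]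
  [HopfAlgebra R H] [Bialgebra R W] {P : H →ₗ[R] W →ₗ[R] R}

/-- The transpose of the antipode of `H` is an antipode. -/
@[reducible]
noncomputable def dualHopfAlgebra (hP : IsAlphaPairing P) (h : IsBialgebraPairing P)
    (S : W →ₗ[R] W) (hS : ∀ a c, P a (S c) = P (HopfAlgebra.antipode R a) c) :
    HopfAlgebra R W where
  antipode := S
  mul_antipode_rTensor_comul := by
    ext c
    refine hP.ext fun a => ?_
    -- In Sweedler notation, pairing `a` with `S(c₁) c₂` gives `⟨S(a₁) a₂, c⟩`, so the antipode
    -- identity of `H` applies.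
    have key : ∀ t : W ⊗[R] W, P a (LinearMap.mul' R W (S.rTensor W t)) =
        ∑ i ∈ (ℛ R a).index,
          pair₂ P (HopfAlgebra.antipode R ((ℛ R a).left i)) ((ℛ R a).right i) t := by
      intro t
      induction t with
      | zero => simp
      | add s t hs ht => simp only [map_add, hs, ht, Finset.sum_add_distrib]
      | tmul x y => simp [h.isConvPairing.apply_mul (ℛ R a), hS]
    change P a (LinearMap.mul' R W (S.rTensor W (comul c))) = P a (algebraMap R W (counit c))
    rw [key]
    simp only [h.pair₂_comul]
    rw [← LinearMap.sum_apply, ← map_sum, HopfAlgebra.sum_antipode_mul_eq_smul,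
      Algebra.algebraMap_eq_smul_one]
    simp [h.one_apply, h.isConvPairing.apply_one, _root_.mul_comm]
  mul_antipode_lTensor_comul := by
    ext c
    refine hP.ext fun a => ?_
    have key : ∀ t : W ⊗[R] W, P a (LinearMap.mul' R W (S.lTensor W t)) =
        ∑ i ∈ (ℛ R a).index,
          pair₂ P ((ℛ R a).left i) (HopfAlgebra.antipode R ((ℛ R a).right i)) t := by
      intro t
      induction t with
      | zero => simp
      | add s t hs ht => simp only [map_add, hs, ht, Finset.sum_add_distrib]
      | tmul x y => simp [h.isConvPairing.apply_mul (ℛ R a), hS]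
    change P a (LinearMap.mul' R W (S.lTensor W (comul c))) = P a (algebraMap R W (counit c))
    rw [key]
    simp only [h.pair₂_comul]
    rw [← LinearMap.sum_apply, ← map_sum, HopfAlgebra.sum_mul_antipode_eq_smul,
      Algebra.algebraMap_eq_smul_one]
    simp [h.one_apply, h.isConvPairing.apply_one, _root_.mul_comm]

end DualHopf
-- Existence of the comultiplication on `H°`
section EvalPairing

variable {R : Type u} [CommRing R] [IsNoetherianRing R] {H : Type v} {K : Type (max u v)} [Ring H]
  [Algebra R H] [AddCommGroup K] [Module R K] (e : K ≃ₗ[R] finiteDual R H)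

@[simp]
lemma evalPairing_apply (h : H) (k : K) :
    evalPairing e h k = (e k : Module.Dual R H) h := rfl

lemma IsAlphaAlgebra.isAlphaPairing (hH : IsAlphaAlgebra R H) :
    IsAlphaPairing (evalPairing e) :=
  IsAlphaPairing.of_equiv hH e fun _ _ => rfl

/-- The multiplication of `H` is dual to a comultiplication on `H°` if `H` is an `α`-algebra. -/
lemma hasComul_evalPairing (hP : IsAlphaPairing (evalPairing e)) : HasComul (evalPairing e) := by
  intro w
  obtain ⟨N, hN, hNle, hNmem⟩ := exists_fg_of_mem_finiteDual (e w).2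
  obtain ⟨n, g, hg⟩ := Submodule.fg_iff_exists_fin_generating_family.1 hN
  have hspan : ∀ a, bitranslate a 1 (e w : Module.Dual R H) ∈ Submodule.span R (Set.range g) :=
    fun a => hg ▸ hNmem a 1
  simp only [Submodule.mem_span_range_iff_exists_fun] at hspan
  choose d hd using hspan
  have hgN : ∀ j, g j ∈ finiteDual R H := fun j =>
    hNle (hg ▸ Submodule.subset_span (Set.mem_range_self j))
  -- The coefficients `d a j` of the left translates are chosen and need not be linear in `a`, so
  -- the first factor is the module of all functions on `H`.
  let t : (H → R) ⊗[R] K := ∑ j, (fun a => d a j) ⊗ₜ e.symm ⟨g j, hgN j⟩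
  have ht : ∀ b a, alphaMap (evalPairing e) (H → R) t b a = (e w : Module.Dual R H) (a * b) := by
    intro b a
    have h := congr($(hd a) b)
    simpa [t, Finset.sum_apply, mul_comm] using h
  let ι : K →ₗ[R] (H → R) := LinearMap.pi fun a => evalPairing e a
  have hr : ∀ b, bitranslate 1 b (e w : Module.Dual R H) ∈ finiteDual R H :=
    fun b => hNle (hNmem 1 b)
  -- The value of `t` at `b` is the right translate `a ↦ f (a * b)`, again in `H°`; hence `t` comes
  -- from `H° ⊗ H°`.
  obtain ⟨s, hs⟩ := hP.exists_rTensor_eq ι t fun b =>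
    ⟨e.symm ⟨_, hr b⟩, by ext a; simp [ι, ht]⟩
  refine ⟨s, fun a b => ?_⟩
  have h := alphaMap_comp_rTensor (P := evalPairing e) ι s b
  rw [hs] at h
  rw [pair₂_eq_alphaMap]
  exact (congr($h a)).symm.trans (ht b a)

end EvalPairing

/-! ### `H°` as a convolution algebra, and its bialgebra and Hopf structures -/

section FiniteDualSubalgebra

open Coalgebra WithConv

variable (R : Type u) [CommRing R] [IsNoetherianRing R] (H : Type v) [Ring H]

section Bialgebra

variable [Bialgebra R H]

/-- The finite dual of a bialgebra as an algebra under convolution. -/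
noncomputable def finiteDualSubalgebra : Subalgebra R (WithConv (H →ₗ[R] R)) where
  carrier := {f | f.ofConv ∈ finiteDual R H}
  add_mem' hf hg := (finiteDual R H).add_mem hf hg
  mul_mem' := by
    intro f g hf hg
    obtain ⟨N, hN, -, hNmem⟩ := exists_fg_of_mem_finiteDual hf
    obtain ⟨N', hN', -, hNmem'⟩ := exists_fg_of_mem_finiteDual hg
    let B : Module.Dual R H →ₗ[R] Module.Dual R H →ₗ[R] Module.Dual R H :=
      LinearMap.mk₂ R (fun f g => (toConv f * toConv g).ofConv)
        (fun _ _ _ => by rw [toConv_add, add_mul]; rfl)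
        (fun _ _ _ => by rw [toConv_smul, smul_mul_assoc]; rfl)
        (fun _ _ _ => by rw [toConv_add, mul_add]; rfl)
        (fun _ _ _ => by rw [toConv_smul, mul_smul_comm]; rfl)
    refine mem_finiteDual_of_fg (hN.map₂ B hN') fun a => ?_
    -- Since `Δ` is multiplicative, `(f * g)(b a) = ∑ f(b₁ a₁) g(b₂ a₂)`: translates of a product
    -- are sums of products of translates.
    have : bitranslate 1 a (f * g).ofConv = ∑ i ∈ (ℛ R a).index,
        B (bitranslate 1 ((ℛ R a).left i) f.ofConv)
          (bitranslate 1 ((ℛ R a).right i) g.ofConv) := by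
      ext b
      have h1 := ((ℛ R b).mul (ℛ R a)).convMul_apply f g
      rw [bitranslate_apply, one_mul]
      refine h1.trans ?_
      rw [LinearMap.sum_apply]
      have h2 : ∀ i, B (bitranslate 1 ((ℛ R a).left i) f.ofConv)
          (bitranslate 1 ((ℛ R a).right i) g.ofConv) b = _ := fun i =>
        (ℛ R b).convMul_apply (toConv (bitranslate 1 ((ℛ R a).left i) f.ofConv))
          (toConv (bitranslate 1 ((ℛ R a).right i) g.ofConv))
      simp only [h2]
      rw [Finset.sum_comm]
      simp [Finset.sum_product]
    rw [this]
    exact Submodule.sum_mem _ fun i _ =>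
      Submodule.apply_mem_map₂ _ (hNmem _ _) (hNmem' _ _)
  algebraMap_mem' := by
    intro r
    refine mem_finiteDual_of_fg (N := Submodule.span R {(counit : H →ₗ[R] R)})
      (Submodule.fg_span_singleton _) fun a => ?_
    refine Submodule.mem_span_singleton.2 ⟨r * counit a, ?_⟩
    ext b
    simp [mul_comm, mul_left_comm]

/-- The type of elements of `H°`, with the convolution product. -/
def FiniteDual : Type (max u v) := finiteDualSubalgebra R H

noncomputable instance : Ring (FiniteDual R H) := inferInstanceAs (Ring (finiteDualSubalgebra R H))

noncomputable instance : Algebra R (FiniteDual R H) :=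
  inferInstanceAs (Algebra R (finiteDualSubalgebra R H))

/-- The identification of `FiniteDual R H` with the module `H°`. -/
noncomputable def finiteDualEquiv : FiniteDual R H ≃ₗ[R] finiteDual R H where
  toFun f := ⟨f.1.ofConv, f.2⟩
  invFun f := ⟨toConv f.1, f.2⟩
  map_add' _ _ := rfl
  map_smul' _ _ := rfl

lemma isConvPairing_finiteDual : IsConvPairing (evalPairing (finiteDualEquiv R H)) where
  one := rfl
  mul _ _ := rfl

variable {R H}

/-- The bialgebra structure on `H°` for an `α`-bialgebra `H`. -/
@[reducible]
noncomputable def finiteDualBialgebra (hP : IsAlphaPairing (evalPairing (finiteDualEquiv R H))) :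
    Bialgebra R (FiniteDual R H) :=
  dualBialgebra hP (hasComul_evalPairing _ hP) (isConvPairing_finiteDual R H)

lemma isBialgebraPairing_finiteDual
    (hP : IsAlphaPairing (evalPairing (finiteDualEquiv R H))) :
    @IsBialgebraPairing R _ H (FiniteDual R H) _ _ _ (finiteDualBialgebra hP)
      (evalPairing (finiteDualEquiv R H)) :=
  isBialgebraPairing_dualBialgebra _ _ _

end Bialgebra

variable [HopfAlgebra R H]

/-- The transpose of the antipode preserves `H°`. -/
lemma comp_antipode_mem_finiteDual {f : Module.Dual R H} (hf : f ∈ finiteDual R H) :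
    f ∘ₗ HopfAlgebra.antipode R ∈ finiteDual R H := by
  obtain ⟨N, hN, -, hNmem⟩ := exists_fg_of_mem_finiteDual hf
  refine mem_finiteDual_of_fg (hN.map (LinearMap.lcomp R R (HopfAlgebra.antipode R))) fun a => ?_
  -- The antipode reverses products, so a right translate of `f ∘ S` by `a` is the left translate of
  -- `f` by `S a`, composed with `S`.
  refine ⟨_, hNmem (HopfAlgebra.antipode R a) 1, ?_⟩
  ext b
  simp [HopfAlgebra.antipode_mul_antidistrib]

/-- The transpose of the antipode on `H°`. -/
noncomputable def finiteDualAntipode : finiteDual R H →ₗ[R] finiteDual R H :=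
  (LinearMap.lcomp R R (HopfAlgebra.antipode R)).restrict fun _ hf =>
    comp_antipode_mem_finiteDual R H hf

variable {R H}

/-- The Hopf algebra structure on `H°` for a Hopf `α`-algebra `H`. -/
@[reducible]
noncomputable def finiteDualHopfAlgebra (hP : IsAlphaPairing (evalPairing (finiteDualEquiv R H))) :
    HopfAlgebra R (FiniteDual R H) :=
  let _ : Bialgebra R (FiniteDual R H) := finiteDualBialgebra hP
  dualHopfAlgebra hP (isBialgebraPairing_finiteDual hP)
    ((finiteDualEquiv R H).symm.toLinearMap ∘ₗ finiteDualAntipode R H ∘ₗ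
      (finiteDualEquiv R H).toLinearMap) fun _ _ => rfl

end FiniteDualSubalgebra

/-! ### The `α`-condition over a hereditary Noetherian ring -/

section Hereditary

variable {R : Type u} [CommRing R]

/-- The first coordinate maps `M` onto an ideal, which is projective, so `M` splits as that ideal
plus a kernel embedded in the remaining coordinates. -/
lemma projective_of_injective_pi (hR : ∀ I : Ideal R, Module.Projective R I) (n : ℕ) :
    ∀ {M : Type v} [AddCommGroup M] [Module R M] (f : M →ₗ[R] (Fin n → R)),
      Function.Injective f → Module.Projective R M := by
  induction n with
  | zero =>
    intro M _ _ f hf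
    have : Subsingleton M := hf.subsingleton
    infer_instance
  | succ n ih =>
    intro M _ _ f hf
    let p : M →ₗ[R] R := LinearMap.proj 0 ∘ₗ f
    have hJ : Module.Projective R (LinearMap.range p) := hR (LinearMap.range p)
    obtain ⟨s, hs⟩ := Module.projective_lifting_property p.rangeRestrict LinearMap.id
      p.surjective_rangeRestrict
    have hker : Module.Projective R (LinearMap.ker p.rangeRestrict) := by
      refine ih (LinearMap.funLeft R R Fin.succ ∘ₗ f ∘ₗ (LinearMap.ker p.rangeRestrict).subtype) ?_
      refine (injective_iff_map_eq_zero _).2 fun x hx => ?_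
      refine Subtype.ext (hf ?_)
      rw [ZeroMemClass.coe_zero, map_zero]
      ext i
      refine Fin.cases ?_ (fun i => ?_) i
      · exact congr((($(LinearMap.mem_ker.1 x.2) : LinearMap.range p) : R))
      · exact congr($hx i)
    exact Module.Projective.of_equiv (lequivProdOfRightSplitExact
      (LinearMap.ker p.rangeRestrict).injective_subtype (Submodule.range_subtype _) hs)

/-- Over a hereditary Noetherian ring, every algebra is an `α`-algebra. -/
lemma isAlphaPairing_evalPairing_of_hereditary [IsNoetherianRing R]
    (hR : ∀ I : Ideal R, Module.Projective R I) {A : Type v} [Ring A] [Algebra R A]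
    {K : Type (max u v)} [AddCommGroup K] [Module R K] (e : K ≃ₗ[R] finiteDual R A) :
    IsAlphaPairing (evalPairing e) := by
  intro M _ _
  refine (injective_iff_map_eq_zero _).2 fun x hx => ?_
  obtain ⟨s, rfl⟩ := TensorProduct.exists_finset x
  obtain ⟨I, hI, hfin, hfI⟩ := exists_ideal_of_finite fun i : s => e i.1.2
  let F₀ : A →ₗ[R] (s → R) := LinearMap.pi fun i => (e i.1.2 : Module.Dual R A)
  let F : A →ₗ[R] (Fin (Fintype.card s) → R) :=
    LinearMap.funLeft R R (Fintype.equivFin s).symm ∘ₗ F₀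
  have hproj : Module.Projective R (LinearMap.range F) :=
    projective_of_injective_pi hR _ (LinearMap.range F).subtype
      (LinearMap.range F).injective_subtype
  -- The retraction `f ∘ g = id` through `R^k` is a dual basis of the image of `F`: the vectors are
  -- `F (a j)`, and the coordinate forms pulled back to `A` are the `β j`. These lie in `A°` because
  -- `F` kills `I`.
  obtain ⟨k, f, g, -, -, hfg⟩ :=
    Module.Finite.exists_comp_eq_id_of_projective R (LinearMap.range F)
  choose a ha using fun j : Fin k => (f (Pi.single j 1)).2
  let β : Fin k → K := fun j => e.symm
    ⟨LinearMap.proj j ∘ₗ g ∘ₗ F.rangeRestrict, I, hI, hfin, fun x hx => by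
      have : F.rangeRestrict x = 0 := Subtype.ext (by ext i; exact hfI _ x hx)
      simp [this]⟩
  have hw : ∀ i : s, i.1.2 = ∑ j, (e i.1.2 : Module.Dual R A) (a j) • β j := by
    intro i
    refine e.injective (Subtype.ext ?_)
    ext x
    have h1 : F.rangeRestrict x = ∑ j, g (F.rangeRestrict x) j • f (Pi.single j 1) := by
      conv_lhs => rw [← LinearMap.id_apply (R := R) (F.rangeRestrict x), ← hfg,
        LinearMap.comp_apply, pi_eq_sum_univ' (g (F.rangeRestrict x))]
      simp
    have h2 := congr((($h1 : LinearMap.range F) : Fin _ → R) (Fintype.equivFin s i))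
    simp only [AddSubmonoidClass.coe_finsetSum, SetLike.val_smul, ← ha, Finset.sum_apply,
      Pi.smul_apply] at h2
    have hF : ∀ y, F y (Fintype.equivFin s i) = (e i.1.2 : Module.Dual R A) y := by
      intro y
      simp [F, F₀, LinearMap.funLeft_apply]
    simp only [hF] at h2
    have h3 : ((F.rangeRestrict x : LinearMap.range F) : Fin _ → R) (Fintype.equivFin s i) =
      (e i.1.2 : Module.Dual R A) x := hF x
    rw [← h3, h2]
    simp [β, mul_comm]
  -- The dual basis rebuilds the tensor from the values of its associated map at the `a j`, so it
  -- vanishes when that map does.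
  have hsum : ∑ i ∈ s, i.1 ⊗ₜ[R] i.2 =
      ∑ j, alphaMap (evalPairing e) M (∑ i ∈ s, i.1 ⊗ₜ[R] i.2) (a j) ⊗ₜ[R] β j := by
    simp only [map_sum, LinearMap.sum_apply, alphaMap_tmul, TensorProduct.sum_tmul]
    rw [Finset.sum_comm]
    refine Finset.sum_congr rfl fun i hi => ?_
    conv_lhs => rw [hw ⟨i, hi⟩]
    simp [TensorProduct.tmul_sum, TensorProduct.smul_tmul]
  rw [hsum, hx]
  simp

end Hereditary
-- Universal property of the finite dual
section PairingHom

open Coalgebra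

variable {R : Type u} [CommRing R] {H : Type v} [Ring H] [Bialgebra R H]

lemma IsBialgebraPairing.comp_left {L W : Type*} [Ring L] [Bialgebra R L] [Ring W]
    [Bialgebra R W] {P : H →ₗ[R] W →ₗ[R] R} (h : IsBialgebraPairing P) (f : L →ₐc[R] H) :
    IsBialgebraPairing (P ∘ₗ (f : L →ₗ[R] H)) where
  left_one := by simpa using h.left_one
  left_mul a b := by simpa using h.left_mul (f a) (f b)
  right_one := by
    ext a
    exact (h.isConvPairing.apply_one (f a)).trans (by simp)
  right_mul c d := by
    ext a
    refine (h.isConvPairing.apply_mul ((ℛ R a).induced f) c d).trans ?_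
    exact ((ℛ R a).convMul_apply (WithConv.toConv ((P ∘ₗ (f : L →ₗ[R] H)).flip c))
      (WithConv.toConv ((P ∘ₗ (f : L →ₗ[R] H)).flip d))).symm

lemma IsBialgebraPairing.comp_right {L W : Type*} [Ring L] [Bialgebra R L] [Ring W]
    [Bialgebra R W] {P : H →ₗ[R] W →ₗ[R] R} (h : IsBialgebraPairing P) (f : L →ₐc[R] W) :
    IsBialgebraPairing (P.compl₂ (f : L →ₗ[R] W)) :=
  (h.flip.comp_left f).flip

/-- In a bialgebra pairing, the elements of the second bialgebra give elements of the finite dual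
of the first one. -/
lemma IsBialgebraPairing.flip_mem_finiteDual [IsNoetherianRing R] {L : Type*} [Ring L]
    [Bialgebra R L] {Q : H →ₗ[R] L →ₗ[R] R} (hQ : IsBialgebraPairing Q) (l : L) :
    Q.flip l ∈ finiteDual R H := by
  let r := ℛ R l
  refine mem_finiteDual_of_fg (N := Submodule.span R ((fun i => Q.flip (r.left i)) '' r.index))
    (Submodule.fg_span (r.index.finite_toSet.image _)) fun a => ?_
  -- From `⟨b a, l⟩ = ∑ ⟨b, l₁⟩ ⟨a, l₂⟩`, all translates lie in the span of the finitely many forms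
  -- `⟨-, l₁⟩`.
  have : bitranslate 1 a (Q.flip l) = ∑ i ∈ r.index, Q a (r.right i) • Q.flip (r.left i) := by
    ext b
    have h := (congr($(hQ.left_mul b a) l)).trans (r.convMul_apply _ _)
    simp only [bitranslate_apply, one_mul, LinearMap.flip_apply, LinearMap.sum_apply,
      LinearMap.smul_apply, smul_eq_mul]
    exact h.trans (Finset.sum_congr rfl fun i _ => _root_.mul_comm _ _)
  rw [this]
  exact Submodule.sum_mem _ fun i hi =>
    Submodule.smul_mem _ _ (Submodule.subset_span (Set.mem_image_of_mem _ hi))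

variable [IsNoetherianRing R] {W : Type w} [Ring W] [Bialgebra R W] (e : W ≃ₗ[R] finiteDual R H)
  {L : Type*} [Ring L] [Bialgebra R L]

/-- The map into the finite dual induced by a bialgebra pairing. -/
noncomputable def IsBialgebraPairing.toFiniteDual {Q : H →ₗ[R] L →ₗ[R] R}
    (hQ : IsBialgebraPairing Q) : L →ₗ[R] W :=
  e.symm.toLinearMap ∘ₗ Q.flip.codRestrict (finiteDual R H) hQ.flip_mem_finiteDual

@[simp]
lemma IsBialgebraPairing.evalPairing_toFiniteDual {Q : H →ₗ[R] L →ₗ[R] R}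
    (hQ : IsBialgebraPairing Q) (h : H) (l : L) :
    evalPairing e h (hQ.toFiniteDual e l) = Q h l := by
  simp [evalPairing, toFiniteDual]

variable {e}

/-- The universal property of the finite dual: a bialgebra pairing `(H, L)` gives a morphism of
bialgebras `L → H°`. -/
noncomputable def IsBialgebraPairing.lift (hP : IsBialgebraPairing (evalPairing e))
    (hα : IsAlphaPairing (evalPairing e)) {Q : H →ₗ[R] L →ₗ[R] R} (hQ : IsBialgebraPairing Q) :
    L →ₐc[R] W :=
  BialgHom.ofAlgHom
    (AlgHom.ofLinearMap (hQ.toFiniteDual e)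
      (hα.ext fun a => by
        rw [hQ.evalPairing_toFiniteDual, hQ.isConvPairing.apply_one, hP.isConvPairing.apply_one])
      (fun c d => hα.ext fun a => by
        rw [hQ.evalPairing_toFiniteDual, hQ.isConvPairing.apply_mul (ℛ R a),
          hP.isConvPairing.apply_mul (ℛ R a)]
        simp only [hQ.evalPairing_toFiniteDual]))
    (by
      ext l
      have h := hQ.evalPairing_toFiniteDual e 1 l
      rwa [hP.one_apply, hQ.one_apply] at h)
    (by
      ext l
      refine hα.ext₂ fun a b => ?_
      have key : ∀ t : L ⊗[R] L, pair₂ (evalPairing e) a b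
          (TensorProduct.map (hQ.toFiniteDual e) (hQ.toFiniteDual e) t) = pair₂ Q a b t := by
        intro t
        induction t with
        | zero => simp
        | add s t hs ht => simp only [map_add, hs, ht]
        | tmul x y => simp only [TensorProduct.map_tmul, pair₂_tmul, hQ.evalPairing_toFiniteDual]
      refine (key _).trans ?_
      refine (hQ.pair₂_comul a b l).trans ?_
      exact ((hP.pair₂_comul a b _).trans (hQ.evalPairing_toFiniteDual e _ l)).symm)

@[simp]
lemma IsBialgebraPairing.evalPairing_lift (hP : IsBialgebraPairing (evalPairing e))
    (hα : IsAlphaPairing (evalPairing e)) {Q : H →ₗ[R] L →ₗ[R] R} (hQ : IsBialgebraPairing Q)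
    (h : H) (l : L) : evalPairing e h (hP.lift hα hQ l) = Q h l :=
  hQ.evalPairing_toFiniteDual e h l

end PairingHom

/-! ### Functoriality and adjunction by means of pairings -/

namespace FiniteDualFunctor

variable {R : Type u} [CommRing R] [IsNoetherianRing R] {C : Type*} [Category C] {D : Type*}
  [Category D] {U : C ⥤ BialgCat.{v} R} {V : D ⥤ BialgCat.{v} R}

section

variable (F : FiniteDualFunctor U V)

/-- The pairing corresponding to a morphism into the dual. -/
noncomputable def pairing {H : C} {X : D} (f : X ⟶ F.functor.obj (op H)) :
    U.obj H →ₗ[R] V.obj X →ₗ[R] R :=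
  (evalPairing (F.equiv H)).compl₂ ((V.map f).toBialgHom : V.obj X →ₗ[R] _)

@[simp]
lemma pairing_apply {H : C} {X : D} (f : X ⟶ F.functor.obj (op H)) (h : U.obj H) (x : V.obj X) :
    F.pairing f h x = evalPairing (F.equiv H) h ((V.map f).toBialgHom x) := rfl

lemma isBialgebraPairing_pairing {H : C} {X : D} (f : X ⟶ F.functor.obj (op H)) :
    IsBialgebraPairing (F.pairing f) :=
  (F.isBialgebraPairing H).comp_right _

lemma hom_ext [V.Faithful] {H : C} {X : D} {f g : X ⟶ F.functor.obj (op H)}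
    (h : ∀ a x, F.pairing f a x = F.pairing g a x) : f = g := by
  refine V.map_injective (BialgCat.hom_ext _ _ (BialgHom.ext fun x => ?_))
  exact (F.isAlphaPairing H).ext fun a => h a x

/-- The morphism into the dual corresponding to a pairing. -/
noncomputable def lift [V.Full] {H : C} {X : D} {Q : U.obj H →ₗ[R] V.obj X →ₗ[R] R}
    (hQ : IsBialgebraPairing Q) : X ⟶ F.functor.obj (op H) :=
  V.preimage (ConcreteCategory.ofHom (C := BialgCat R)
    ((F.isBialgebraPairing H).lift (F.isAlphaPairing H) hQ))

@[simp]
lemma pairing_lift [V.Full] {H : C} {X : D} {Q : U.obj H →ₗ[R] V.obj X →ₗ[R] R}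
    (hQ : IsBialgebraPairing Q) (h : U.obj H) (x : V.obj X) :
    F.pairing (F.lift hQ) h x = Q h x := by
  rw [pairing_apply, lift, V.map_preimage]
  exact (F.isBialgebraPairing H).evalPairing_lift (F.isAlphaPairing H) hQ h x

variable (G : FiniteDualFunctor V U)

/-- The adjoint of a morphism into the dual. -/
noncomputable def transpose [U.Full] {H : C} {X : D} (f : X ⟶ F.functor.obj (op H)) :
    H ⟶ G.functor.obj (op X) :=
  G.lift (F.isBialgebraPairing_pairing f).flip

@[simp]
lemma pairing_transpose [U.Full] {H : C} {X : D} (f : X ⟶ F.functor.obj (op H)) (h : U.obj H)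
    (x : V.obj X) : G.pairing (F.transpose G f) x h = F.pairing f h x :=
  G.pairing_lift _ x h

lemma pairing_comp {H : C} {X Y : D} (g : X ⟶ Y) (f : Y ⟶ F.functor.obj (op H)) (h : U.obj H)
    (x : V.obj X) : F.pairing (g ≫ f) h x = F.pairing f h ((V.map g).toBialgHom x) := by
  simp

lemma pairing_comp_map {H H' : C} {X : D} (f : X ⟶ F.functor.obj (op H)) (g : H' ⟶ H)
    (h : U.obj H') (x : V.obj X) :
    F.pairing (f ≫ F.functor.map g.op) h x = F.pairing f ((U.map g).toBialgHom h) x := by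
  rw [pairing_comp, pairing_apply, F.map_apply, ← pairing_apply]

/-- The bijection `Hom(H, K°) ≃ Hom(K, H°)`. -/
noncomputable def homEquiv [U.Full] [U.Faithful] [V.Full] [V.Faithful] (H : C) (X : D) :
    (X ⟶ F.functor.obj (op H)) ≃ (H ⟶ G.functor.obj (op X)) where
  toFun := F.transpose G
  invFun := G.transpose F
  left_inv f := F.hom_ext fun a x => by simp only [pairing_transpose]
  right_inv f := G.hom_ext fun a x => by simp only [pairing_transpose]

/-- Morphisms into a dual are determined by their pairings, and composition substitutes in one
variable of the pairing. Naturality thus says that substitution commutes with exchanging the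
variables. -/
theorem isAdjointTo [U.Full] [U.Faithful] [V.Full] [V.Faithful] : F.IsAdjointTo G := by
  let core : Adjunction.CoreHomEquiv F.functor.rightOp G.functor :=
    { homEquiv := fun H X => (opEquiv _ _).trans (F.homEquiv G H X.unop)
      homEquiv_naturality_left_symm := fun {H' H X} f g => Quiver.Hom.unop_inj <|
        F.hom_ext fun a x => by
          change F.pairing (G.transpose F (f ≫ g)) a x =
            F.pairing (G.transpose F g ≫ F.functor.map f.op) a x
          rw [pairing_comp_map, pairing_transpose, pairing_transpose, pairing_comp]
      homEquiv_naturality_right := fun {H X Y} f g => G.hom_ext fun x a => by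
          change G.pairing (F.transpose G (g.unop ≫ f.unop)) x a =
            G.pairing (F.transpose G f.unop ≫ G.functor.map g) x a
          have := G.pairing_comp_map (F.transpose G f.unop) g.unop x a
          rw [Quiver.Hom.op_unop] at this
          rw [this, pairing_transpose, pairing_transpose, pairing_comp] }
  refine ⟨Adjunction.mkOfHomEquiv core, fun H K f h k => ?_⟩
  rw [Adjunction.mkOfHomEquiv_homEquiv]
  exact G.pairing_transpose F f k h

end

variable [V.Full] (obj : C → D) (e : ∀ H, V.obj (obj H) ≃ₗ[R] finiteDual R (U.obj H))
  (hP : ∀ H, IsBialgebraPairing (evalPairing (e H)))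
  (hα : ∀ H, IsAlphaPairing (evalPairing (e H)))

/-- The morphism `K° ⟶ H°` induced by `f : H ⟶ K`. -/
noncomputable def dualMap {H K : C} (f : H ⟶ K) : obj K ⟶ obj H :=
  V.preimage (ConcreteCategory.ofHom (C := BialgCat R)
    ((hP H).lift (hα H) ((hP K).comp_left (U.map f).toBialgHom)))

lemma evalPairing_dualMap {H K : C} (f : H ⟶ K) (h : U.obj H) (x : V.obj (obj K)) :
    evalPairing (e H) h ((V.map (dualMap obj e hP hα f)).toBialgHom x) =
      evalPairing (e K) ((U.map f).toBialgHom h) x := by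
  rw [dualMap, V.map_preimage]
  exact (hP H).evalPairing_lift (hα H) _ h x

/-- A choice of objects carrying the dual bialgebras determines the functor `(-)°`. -/
noncomputable def ofObj [V.Faithful] : FiniteDualFunctor U V where
  functor :=
    { obj := fun H => obj H.unop
      map := fun f => dualMap obj e hP hα f.unop
      map_id := fun H => V.map_injective <| BialgCat.hom_ext _ _ <| BialgHom.ext fun x =>
        (hα H.unop).ext fun a => by
          rw [evalPairing_dualMap]
          simp
      map_comp := fun {H K L} f g => V.map_injective <| BialgCat.hom_ext _ _ <|
        BialgHom.ext fun x => (hα L.unop).ext fun a => by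
          rw [evalPairing_dualMap, V.map_comp, BialgCat.toBialgHom_comp, BialgHom.comp_apply,
            evalPairing_dualMap, evalPairing_dualMap]
          simp }
  equiv := e
  isBialgebraPairing := hP
  isAlphaPairing := hα
  map_apply f φ h := evalPairing_dualMap obj e hP hα f h φ

end FiniteDualFunctor

/-- Morphisms of Hopf algebras are bialgebra morphisms with no condition on antipodes, so the formal
argument for full and faithful forgetful functors covers Hopf algebras. -/
instance (R : Type u) [CommRing R] :
    (forget₂ (HopfAlgCat.{v} R) (BialgCat.{v} R)).Full where
  map_surjective f := ⟨ConcreteCategory.ofHom (C := HopfAlgCat R) f.toBialgHom, rfl⟩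

instance (R : Type u) [CommRing R] :
    (forget₂ (HopfAlgCat.{v} R) (BialgCat.{v} R)).Faithful where
  map_injective h := HopfAlgCat.hom_ext _ _ congr(BialgCat.Hom.toBialgHom $h)
-- The dual objects and the resulting functors
section Existence

variable {R : Type u} [CommRing R] [IsNoetherianRing R]

/-- The finite dual of an `α`-bialgebra. -/
noncomputable def finiteDualBialgCat {H : Type v} [Ring H] [Bialgebra R H]
    (hP : IsAlphaPairing (evalPairing (finiteDualEquiv R H))) : BialgCat.{max u v} R :=
  let _ : Bialgebra R (FiniteDual R H) := finiteDualBialgebra hP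
  BialgCat.of R (FiniteDual R H)

/-- The finite dual of a Hopf `α`-algebra. -/
noncomputable def finiteDualHopfAlgCat {H : Type v} [Ring H] [HopfAlgebra R H]
    (hP : IsAlphaPairing (evalPairing (finiteDualEquiv R H))) : HopfAlgCat.{max u v} R :=
  let _ : HopfAlgebra R (FiniteDual R H) := finiteDualHopfAlgebra hP
  HopfAlgCat.of R (FiniteDual R H)

theorem exists_dual_bialgebra (H : Type v) [Ring H] [Bialgebra R H] (hH : IsAlphaAlgebra R H) :
    ∃ (K : BialgCat.{max u v} R) (e : K ≃ₗ[R] finiteDual R H),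
      IsBialgebraPairing (evalPairing e) ∧ IsAlphaPairing (evalPairing e) ∧
      ((∀ a b : H, a * b = b * a) → Coalgebra.IsCocomm R K) ∧
      (Coalgebra.IsCocomm R H → ∀ c d : K, c * d = d * c) := by
  have hα := hH.isAlphaPairing (finiteDualEquiv R H)
  let K := finiteDualBialgCat hα
  let e : K ≃ₗ[R] finiteDual R H := finiteDualEquiv R H
  have hP : IsBialgebraPairing (evalPairing e) := isBialgebraPairing_finiteDual hα
  exact ⟨K, e, hP, hα, hP.isCocomm hα, hP.mul_comm hα⟩

theorem exists_dual_hopfAlgebra (H : Type v) [Ring H] [HopfAlgebra R H]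
    (hH : IsAlphaAlgebra R H) :
    ∃ (K : HopfAlgCat.{max u v} R) (e : K ≃ₗ[R] finiteDual R H),
      IsBialgebraPairing (evalPairing e) ∧ IsAlphaPairing (evalPairing e) ∧
      ((∀ a b : H, a * b = b * a) → Coalgebra.IsCocomm R K) ∧
      (Coalgebra.IsCocomm R H → ∀ c d : K, c * d = d * c) := by
  have hα := hH.isAlphaPairing (finiteDualEquiv R H)
  let K := finiteDualHopfAlgCat hα
  let e : K ≃ₗ[R] finiteDual R H := finiteDualEquiv R H
  have hP : IsBialgebraPairing (evalPairing e) := isBialgebraPairing_finiteDual hα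
  exact ⟨K, e, hP, hα, hP.isCocomm hα, hP.mul_comm hα⟩

variable (hR : ∀ I : Ideal R, Module.Projective R I)

section

variable (H : Type v) [Ring H]

/-- The dual of a bialgebra over a hereditary ring. -/
noncomputable abbrev dualBialgCat [Bialgebra R H] : BialgCat.{max u v} R :=
  finiteDualBialgCat (isAlphaPairing_evalPairing_of_hereditary hR (finiteDualEquiv R H))

/-- The dual of a Hopf algebra over a hereditary ring. -/
noncomputable abbrev dualHopfAlgCat [HopfAlgebra R H] : HopfAlgCat.{max u v} R :=
  finiteDualHopfAlgCat (isAlphaPairing_evalPairing_of_hereditary hR (finiteDualEquiv R H))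

/-- The module underlying the dual bialgebra. -/
noncomputable def dualBialgCatEquiv [Bialgebra R H] : dualBialgCat hR H ≃ₗ[R] finiteDual R H :=
  finiteDualEquiv R H

variable [Bialgebra R H]

lemma isAlphaPairing_dualBialgCat : IsAlphaPairing (evalPairing (dualBialgCatEquiv hR H)) :=
  isAlphaPairing_evalPairing_of_hereditary hR (finiteDualEquiv R H)

lemma isBialgebraPairing_dualBialgCat :
    IsBialgebraPairing (evalPairing (dualBialgCatEquiv hR H)) :=
  isBialgebraPairing_finiteDual (isAlphaPairing_evalPairing_of_hereditary hR (finiteDualEquiv R H))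

end

/-- Carries the two properties along an equality of objects, so that one construction serves every
category lying over bialgebras. -/
lemma evalPairing_of_eq {H : Type v} [Ring H] [Bialgebra R H] {K : BialgCat.{max u v} R}
    (h : K = dualBialgCat hR H) :
    IsBialgebraPairing (evalPairing (K := K) (h ▸ dualBialgCatEquiv hR H)) ∧
      IsAlphaPairing (evalPairing (K := K) (h ▸ dualBialgCatEquiv hR H)) := by
  subst h
  exact ⟨isBialgebraPairing_dualBialgCat hR H, isAlphaPairing_dualBialgCat hR H⟩

/-- The functor `(-)°` for a choice of objects lying over the dual bialgebras. -/
noncomputable def hereditaryFunctor {C : Type*} [Category C] {D : Type*} [Category D]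
    (U : C ⥤ BialgCat.{max u v} R) (V : D ⥤ BialgCat.{max u v} R) [V.Full] [V.Faithful]
    (obj : C → D) (h : ∀ H, V.obj (obj H) = dualBialgCat hR (U.obj H)) : FiniteDualFunctor U V :=
  .ofObj obj (fun H => h H ▸ dualBialgCatEquiv hR (U.obj H))
    (fun H => (evalPairing_of_eq hR (h H)).1) (fun H => (evalPairing_of_eq hR (h H)).2)

lemma isCocomm_dualBialgCat (H : Type v) [Ring H] [Bialgebra R H]
    (hH : ∀ a b : H, a * b = b * a) : Coalgebra.IsCocomm R (dualBialgCat hR H) :=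
  (isBialgebraPairing_dualBialgCat hR H).isCocomm (isAlphaPairing_dualBialgCat hR H) hH

lemma mul_comm_dualBialgCat (H : Type v) [Ring H] [Bialgebra R H]
    (hH : Coalgebra.IsCocomm R H) (c d : dualBialgCat hR H) : c * d = d * c :=
  (isBialgebraPairing_dualBialgCat hR H).mul_comm (isAlphaPairing_dualBialgCat hR H) hH c d

end Existence

theorem mainTheorem6 (R : Type u) [CommRing R] [Nontrivial R] [IsNoetherianRing R] :
    -- `(H, H°)` is a bialgebra `α`-pairing for every `α`-bialgebra `H`
    (∀ (H : Type v) [Ring H] [Bialgebra R H], IsAlphaAlgebra R H →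
      ∃ (K : BialgCat.{max u v} R) (e : K ≃ₗ[R] finiteDual R H),
        IsBialgebraPairing (evalPairing e) ∧ IsAlphaPairing (evalPairing e) ∧
        ((∀ a b : H, a * b = b * a) → Coalgebra.IsCocomm R K) ∧
        (Coalgebra.IsCocomm R H → ∀ c d : K, c * d = d * c)) ∧
    -- `(H, H°)` is a Hopf `α`-pairing for every Hopf `α`-algebra `H`
    (∀ (H : Type v) [Ring H] [HopfAlgebra R H], IsAlphaAlgebra R H →
      ∃ (K : HopfAlgCat.{max u v} R) (e : K ≃ₗ[R] finiteDual R H),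
        IsBialgebraPairing (evalPairing e) ∧ IsAlphaPairing (evalPairing e) ∧
        ((∀ a b : H, a * b = b * a) → Coalgebra.IsCocomm R K) ∧
        (Coalgebra.IsCocomm R H → ∀ c d : K, c * d = d * c)) ∧
    -- the case of a hereditary ring `R`
    ((∀ I : Ideal R, Module.Projective R I) →
      (∃ F : FiniteDualFunctor (𝟭 (BialgCat.{max u v} R)) (𝟭 (BialgCat.{max u v} R)),
        F.IsAdjointTo F) ∧
      (∃ F : FiniteDualFunctor
          (forget₂ (HopfAlgCat.{max u v} R) (BialgCat.{max u v} R))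
          (forget₂ (HopfAlgCat.{max u v} R) (BialgCat.{max u v} R)),
        F.IsAdjointTo F) ∧
      (∃ (F : FiniteDualFunctor
            (BialgCat.comm.{u, max u v} R).ι (BialgCat.cocomm.{u, max u v} R).ι)
         (G : FiniteDualFunctor
            (BialgCat.cocomm.{u, max u v} R).ι (BialgCat.comm.{u, max u v} R).ι),
        F.IsAdjointTo G ∧ G.IsAdjointTo F) ∧
      (∃ (F : FiniteDualFunctor
            ((HopfAlgCat.comm.{u, max u v} R).ι ⋙ forget₂ _ (BialgCat.{max u v} R))
            ((HopfAlgCat.cocomm.{u, max u v} R).ι ⋙ forget₂ _ (BialgCat.{max u v} R)))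
         (G : FiniteDualFunctor
            ((HopfAlgCat.cocomm.{u, max u v} R).ι ⋙ forget₂ _ (BialgCat.{max u v} R))
            ((HopfAlgCat.comm.{u, max u v} R).ι ⋙ forget₂ _ (BialgCat.{max u v} R))),
        F.IsAdjointTo G ∧ G.IsAdjointTo F)) := by
  refine ⟨exists_dual_bialgebra, exists_dual_hopfAlgebra, fun hR => ⟨?_, ?_, ?_, ?_⟩⟩
  · exact ⟨hereditaryFunctor hR _ _ (fun H => dualBialgCat hR H) fun _ => rfl,
      FiniteDualFunctor.isAdjointTo _ _⟩
  · exact ⟨hereditaryFunctor hR _ _ (fun H => dualHopfAlgCat hR H) fun _ => rfl,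
      FiniteDualFunctor.isAdjointTo _ _⟩
  · exact ⟨hereditaryFunctor hR _ _
        (fun H => ⟨dualBialgCat hR H.1, isCocomm_dualBialgCat hR H.1 H.2⟩) fun _ => rfl,
      hereditaryFunctor hR _ _
        (fun H => ⟨dualBialgCat hR H.1, mul_comm_dualBialgCat hR H.1 H.2⟩) fun _ => rfl,
      FiniteDualFunctor.isAdjointTo _ _, FiniteDualFunctor.isAdjointTo _ _⟩
  · exact ⟨hereditaryFunctor hR _ _
        (fun H => ⟨dualHopfAlgCat hR H.1, isCocomm_dualBialgCat hR H.1 H.2⟩) fun _ => rfl,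
      hereditaryFunctor hR _ _
        (fun H => ⟨dualHopfAlgCat hR H.1, mul_comm_dualBialgCat hR H.1 H.2⟩) fun _ => rfl,
      FiniteDualFunctor.isAdjointTo _ _, FiniteDualFunctor.isAdjointTo _ _⟩
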